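/- For $\Phi:[-\pi,\pi)\to\mathbb{R}$ continuous and strictly positive with $\Phi(-\pi)=\lim_{\omega\to\pi}\Phi(\omega)$, put, for $|z|<1$, $$g_\Phi(z)=\frac1{2\pi}\int_{-\pi}^{\pi}\log\Phi(\tau)\,\frac{e^{i\tau}+z}{e^{i\tau}-z}\,d\tau ,\qquad F_+=e^{g_\Phi},\qquad \Phi_+=F_+^{1/2}=e^{g_\Phi/2},\qquad H_W=1/\Phi_+=F_+^{-1/2},$$ and $\Phi_-(z)=\overline{\Phi_+(1/\overline z)}$ for $|z|>1$. Let $\mathcal D$ be the open unit disk and $\mathcal A(\mathcal D)$ the disk algebra, i.e. the functions analytic in $\mathcal D$ and continuous on $\overline{\mathcal D}$ (a function given on $\mathcal D$, or on $\mathcal D\setminus\{0\}$ with a removable singularity at $0$, belongs to $\mathcal A(\mathcal D)$ if it has an extension in it). There exists such a $\Phi$ with all of the following properties. (a) There are no functions $P$, $M$ with $P(z)\in\mathcal A(\mathcal D)$ and $M(1/z)\in\mathcal A(\mathcal D)$ such that $P$ has no zero in $\mathcal D$, $M$ is analytic with no zero in $\{|z|>1\}$, and $\Phi(\omega)=P(e^{-i\omega})M(e^{-i\omega})$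 for all $\omega\in[-\pi,\pi)$. Moreover, neither of the spectral factors $\Phi_+(z)$ and $\Phi_-(1/z)$ belongs to $\mathcal A(\mathcal D)$. (b) The whitening filter $H_W$ does not belong to $\mathcal A(\mathcal D)$. (c) $H_W$ cannot be approximated uniformly by FIR filters: let $h_k$ be the Taylor coefficients of $H_W$ at $0$ for $k\ge 0$, and $h_k=0$ for $k<0$. Then there are no sequences $g^{(N)}=(g^{(N)}_k)_{k\in\mathbb Z}$, $N\in\mathbb{N}$, with $g^{(N)}_k=0$ unless $0\le k\le N$, such that $$\sup_{\|x\|_{\ell^2(\mathbb Z)}\le 1}\big\|(h-g^{(N)})*x\big\|_{\ell^2(\mathbb Z)}\to 0\quad\text{as } N\to\infty .$$ -/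

import Mathlib

open scoped ENNReal Topology

namespace WienerFilter

/-- The class of real-valued, strictly positive, continuous functions on `[-π, π)` with
`Φ (-π) = lim_{ω → π} Φ ω` (values outside `[-π, π)` are irrelevant). -/
structure IsPositiveContinuousDensity (Φ : ℝ → ℝ) : Prop where
  continuousOn : ContinuousOn Φ (Set.Ico (-Real.pi) Real.pi)
  tendsto_endpoint : Filter.Tendsto Φ (𝓝[<] Real.pi) (𝓝 (Φ (-Real.pi)))
  pos : ∀ ω ∈ Set.Ico (-Real.pi) Real.pi, 0 < Φ ω

/-- A function `f` given on the open unit disk belongs to the disk algebra: it is analytic there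
and has a continuous extension to the closed unit disk. -/
def MemDiskAlgebra (f : ℂ → ℂ) : Prop :=
  ∃ g : ℂ → ℂ, DiffContOnCl ℂ g (Metric.ball 0 1) ∧ Set.EqOn f g (Metric.ball 0 1)

/-- `Φ(ω) = P(e^{-iω}) M(e^{-iω})` on `[-π, π)`, with `P` analytic and zero-free in the open unit
disk and `M` analytic and zero-free outside the closed unit disk. -/
structure IsSpectralFactorization (Φ : ℝ → ℝ) (P M : ℂ → ℂ) : Prop where
  plus_analytic : DifferentiableOn ℂ P {z | ‖z‖ < 1}
  plus_ne_zero : ∀ z, ‖z‖ < 1 → P z ≠ 0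
  minus_analytic : DifferentiableOn ℂ M {z | 1 < ‖z‖}
  minus_ne_zero : ∀ z, 1 < ‖z‖ → M z ≠ 0
  factor : ∀ ω ∈ Set.Ico (-Real.pi) Real.pi,
    (Φ ω : ℂ) = P (Complex.exp (-(Complex.I * ω))) * M (Complex.exp (-(Complex.I * ω)))

/-- `P(z) ∈ A(D)` and `M(1/z) ∈ A(D)`, where `P` and `M` also have prescribed values on the unit
circle, which have to be the boundary values. The value of `M(1/z)` at `z = 0` is the one obtained
by removing the singularity. -/
def FactorsInDiskAlgebra (P M : ℂ → ℂ) : Prop :=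
  DiffContOnCl ℂ P (Metric.ball 0 1) ∧
    ∃ Q : ℂ → ℂ, DiffContOnCl ℂ Q (Metric.ball 0 1) ∧
      ∀ z : ℂ, z ≠ 0 → ‖z‖ ≤ 1 → Q z = M (1 / z)

/-- The exponent in the outer function of `Φ`. -/
noncomputable def outerExponent (Φ : ℝ → ℝ) (z : ℂ) : ℂ :=
  1 / (2 * Real.pi) * ∫ τ in (-Real.pi)..Real.pi, (Real.log (Φ τ) : ℂ) *
    ((Complex.exp (Complex.I * τ) + z) / (Complex.exp (Complex.I * τ) - z))

/-- The outer function `F₊` of `Φ`. -/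
noncomputable def outerFunction (Φ : ℝ → ℝ) (z : ℂ) : ℂ :=
  Complex.exp (outerExponent Φ z)

/-- The spectral factor `Φ₊ = F₊^{1/2}`: the analytic branch of the root in the unit disk that is
positive at `0`. -/
noncomputable def spectralPlus (Φ : ℝ → ℝ) (z : ℂ) : ℂ :=
  Complex.exp (outerExponent Φ z / 2)

/-- The branch is a square root of the outer function. -/
theorem spectralPlus_sq (Φ : ℝ → ℝ) (z : ℂ) : spectralPlus Φ z ^ 2 = outerFunction Φ z := by
  rw [spectralPlus, outerFunction, ← Complex.exp_nat_mul]
  congr 1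
  push_cast
  ring

/-- The spectral factor `Φ₋`, obtained from `Φ₊` by reflection in the unit circle. -/
noncomputable def spectralMinus (Φ : ℝ → ℝ) (z : ℂ) : ℂ :=
  (starRingEnd ℂ) (spectralPlus Φ (1 / (starRingEnd ℂ) z))

/-- The whitening filter `H_W = 1 / Φ₊ = F₊^{-1/2}`. -/
noncomputable def whiteningFilter (Φ : ℝ → ℝ) (z : ℂ) : ℂ :=
  1 / spectralPlus Φ z

/-- The `ℓ²`-norm of a two-sided sequence, with values in `[0, ∞]`. -/
noncomputable def energyNorm (x : ℤ → ℂ) : ℝ≥0∞ :=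
  (∑' n : ℤ, ‖x n‖ₑ ^ 2) ^ (1 / 2 : ℝ)

/-- The output `y n = ∑ k, h k * x (n - k)` of the linear time-invariant system with impulse
response `h` on the input `x`. -/
noncomputable def systemOutput (h x : ℤ → ℂ) (n : ℤ) : ℂ :=
  ∑' k : ℤ, h k * x (n - k)

open Classical in
/-- The `ℓ²`-norm of the output; it is `∞` if one of the defining series does not converge. -/
noncomputable def outputEnergyNorm (h x : ℤ → ℂ) : ℝ≥0∞ :=
  if ∀ n : ℤ, Summable (fun k : ℤ => h k * x (n - k)) then energyNorm (systemOutput h x) else ⊤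

/-- The stability norm of the system with impulse response `h`: the supremum of `‖h * x‖₂` over
all inputs with `‖x‖₂ ≤ 1`. -/
noncomputable def stabilityNorm (h : ℤ → ℂ) : ℝ≥0∞ :=
  ⨆ (x : ℤ → ℂ) (_ : energyNorm x ≤ 1), outputEnergyNorm h x

/-- The system with impulse response `h` can be approximated uniformly by FIR filters `g N` of
degree at most `N`. -/
def FIRApproximable (h : ℤ → ℂ) : Prop :=
  ∃ g : ℕ → ℤ → ℂ, (∀ (N : ℕ) (k : ℤ), k < 0 ∨ (N : ℤ) < k → g N k = 0) ∧
    Filter.Tendsto (fun N : ℕ => stabilityNorm (fun k => h k - g N k)) Filter.atTop (𝓝 0)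

/-- The impulse response of the causal system whose transfer function is the analytic function `H`
on the unit disk: the Taylor coefficients of `H` at `0`, and `0` at negative times. -/
noncomputable def impulseResponse (H : ℂ → ℂ) (k : ℤ) : ℂ :=
  if 0 ≤ k then iteratedDeriv k.toNat H 0 / (k.toNat.factorial : ℂ) else 0

end WienerFilter

namespace WienerFilter

open Complex Filter Metric Set

/-! The example is an analytic function on the disk whose real part is continuous up to the circle
while its imaginary part is unbounded: `I * log (1 - log (1 - z))`. Its real part `-arg (1 - log (1
- z))` tends to 0 at `1`, so the exponential of its boundary values is a continuous positive
density, and the function itself is the outer exponent (`outerExponent_density`). Along a path to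
`1` it equals `I * u` with `u → ∞`, so the spectral factors and the whitening filter oscillate there
without a limit.

For FIR filters, the stability norm of a causal system dominates its transfer function on the disk
(`enorm_le_stabilityNorm`); an approximation would be uniform by polynomials, which do have a limit
at `1`.

For an arbitrary factorization `P`, `M`, reflecting `M` in the circle gives a disk algebra function
whose quotient by `P` is real on the circle, hence constant. So `‖P‖ ^ 2` is a multiple of the
density on the circle up to conjugation, which forces `P ^ 2` to be a multiple of `exp
(-logLogPole)`, again oscillating. -/

/-! ### Stability norm and transfer function -/

theorem energyNorm_mono {x y : ℤ → ℂ} (h : ∀ n, ‖x n‖ₑ ≤ ‖y n‖ₑ) :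
    energyNorm x ≤ energyNorm y := by
  unfold energyNorm
  gcongr with n
  exact h n

theorem energyNorm_const_mul (c : ℂ) (x : ℤ → ℂ) :
    energyNorm (fun n => c * x n) = ‖c‖ₑ * energyNorm x := by
  unfold energyNorm
  simp only [enorm_mul, mul_pow, ENNReal.tsum_mul_left]
  rw [ENNReal.mul_rpow_of_nonneg _ _ (by norm_num), ← ENNReal.rpow_natCast, ← ENNReal.rpow_mul]
  norm_num

/-- The sequence `n ↦ z ^ (-n)` on the nonpositive integers, continued by zero. -/
noncomputable def anticausalGeometric (z : ℂ) (n : ℤ) : ℂ :=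
  if n ≤ 0 then z ^ n.natAbs else 0

theorem energyNorm_anticausalGeometric_ne_zero (z : ℂ) :
    energyNorm (anticausalGeometric z) ≠ 0 := by
  have h : (1 : ℝ≥0∞) ≤ ∑' n : ℤ, ‖anticausalGeometric z n‖ₑ ^ 2 := by
    refine le_trans ?_ (ENNReal.le_tsum 0)
    simp [anticausalGeometric]
  unfold energyNorm
  have : ∑' n : ℤ, ‖anticausalGeometric z n‖ₑ ^ 2 ≠ 0 := (zero_lt_one.trans_le h).ne'
  rw [Ne, ENNReal.rpow_eq_zero_iff_of_pos (by norm_num)]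
  exact this

theorem energyNorm_anticausalGeometric_ne_top {z : ℂ} (hz : ‖z‖ < 1) :
    energyNorm (anticausalGeometric z) ≠ ⊤ := by
  have hinj : Function.Injective (fun m : ℕ => -(m : ℤ)) := fun a b h => by simpa using h
  have hsum : ∑' n : ℤ, ‖anticausalGeometric z n‖ₑ ^ 2 = ∑' m : ℕ, (‖z‖ₑ ^ 2) ^ m := by
    rw [← hinj.tsum_eq]
    · refine tsum_congr fun m => ?_
      simp [anticausalGeometric, ← pow_mul, mul_comm]
    · intro n hn
      rcases le_or_gt n 0 with h | h
      · exact ⟨n.natAbs, by simp only; omega⟩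
      · exact absurd (by simp [anticausalGeometric, h.not_ge]) hn
  have hlt : ‖z‖ₑ ^ 2 < 1 := by
    refine pow_lt_one₀ zero_le ?_ two_ne_zero
    rwa [← ofReal_norm, ENNReal.ofReal_lt_one]
  unfold energyNorm
  rw [hsum, ENNReal.tsum_geometric]
  refine ENNReal.rpow_ne_top_of_nonneg (by norm_num) ?_
  simpa [tsub_eq_zero_iff_le] using hlt

/-- At times `n ≤ 0` a causal filter sees only the geometric part of the input, which behaves like
an eigenvector with eigenvalue the transfer function at `z`. -/
theorem hasSum_mul_anticausalGeometric {h : ℤ → ℂ} (hh : ∀ k < 0, h k = 0) {z S : ℂ}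
    (hS : HasSum (fun k : ℕ => h k * z ^ k) S) {n : ℤ} (hn : n ≤ 0) :
    HasSum (fun k : ℤ => h k * anticausalGeometric z (n - k))
      (S * anticausalGeometric z n) := by
  rw [← Nat.cast_injective.hasSum_iff (f := fun k : ℤ => h k * anticausalGeometric z (n - k))]
  · refine (hS.mul_right (anticausalGeometric z n)).congr_fun fun k => ?_
    have h1 : n - (k : ℤ) ≤ 0 := by omega
    have h2 : (n - (k : ℤ)).natAbs = k + n.natAbs := by omega
    rw [Function.comp_apply, anticausalGeometric, anticausalGeometric, if_pos h1, if_pos hn, h2,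
      pow_add, mul_assoc]
  · intro k hk
    rw [hh k, zero_mul]
    by_contra hlt
    exact hk ⟨k.toNat, by omega⟩

/-- The stability norm of a causal system dominates its transfer function on the unit disk. -/
theorem enorm_le_stabilityNorm {h : ℤ → ℂ} (hh : ∀ k < 0, h k = 0) {z S : ℂ} (hz : ‖z‖ < 1)
    (hS : HasSum (fun k : ℕ => h k * z ^ k) S) : ‖S‖ₑ ≤ stabilityNorm h := by
  set E := energyNorm (anticausalGeometric z) with hE
  have hE0 : E ≠ 0 := energyNorm_anticausalGeometric_ne_zero z
  have hEt : E ≠ ⊤ := energyNorm_anticausalGeometric_ne_top hz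
  set c : ℂ := ((E.toReal⁻¹ : ℝ) : ℂ) with hc
  have hcE : ‖c‖ₑ * E = 1 := by
    have : ‖c‖ₑ = E⁻¹ := by
      rw [hc, ← ofReal_norm, Complex.norm_real, Real.norm_of_nonneg (by positivity),
        ← ENNReal.toReal_inv, ENNReal.ofReal_toReal (by simpa using hE0)]
    rw [this, ENNReal.inv_mul_cancel hE0 hEt]
  set x : ℤ → ℂ := fun n => c * anticausalGeometric z n with hx
  have hx1 : energyNorm x = 1 := by rw [hx, energyNorm_const_mul, ← hE, hcE]
  have hout : ∀ n ≤ 0, systemOutput h x n = S * x n := by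
    intro n hn
    have := (hasSum_mul_anticausalGeometric hh hS hn).mul_left c
    rw [systemOutput, hx]
    convert this.tsum_eq using 1
    · exact tsum_congr fun k => by ring
    · ring
  have hle : ‖S‖ₑ ≤ outputEnergyNorm h x := by
    unfold outputEnergyNorm
    split_ifs
    · calc ‖S‖ₑ = energyNorm (fun n => S * x n) := by rw [energyNorm_const_mul, hx1, mul_one]
        _ ≤ _ := energyNorm_mono fun n => by
          rcases le_or_gt n 0 with hn | hn
          · rw [hout n hn]
          -- The output at positive times is not controlled, but the input vanishes there.
          · simp [hx, anticausalGeometric, hn.not_ge]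
    · exact le_top
  exact hle.trans (le_iSup₂_of_le x hx1.le le_rfl)

/-- An analytic function on the disk whose impulse response is approximable by FIR filters is
approximable uniformly on the disk by continuous functions. -/
theorem FIRApproximable.exists_continuous_norm_sub_le {H : ℂ → ℂ}
    (hH : DifferentiableOn ℂ H (ball 0 1)) (hf : FIRApproximable (impulseResponse H))
    {ε : ℝ} (hε : 0 < ε) :
    ∃ G : ℂ → ℂ, Continuous G ∧ ∀ z ∈ ball (0 : ℂ) 1, ‖H z - G z‖ ≤ ε := by
  obtain ⟨g, hg, hlim⟩ := hf
  obtain ⟨N, hN⟩ := (hlim.eventually_le_const (u := ENNReal.ofReal ε) (by simpa using hε)).exists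
  refine ⟨fun z => ∑ k ∈ Finset.range (N + 1), g N k * z ^ k, by fun_prop, fun z hz => ?_⟩
  have hG : HasSum (fun k : ℕ => g N k * z ^ k) (∑ k ∈ Finset.range (N + 1), g N k * z ^ k) :=
    hasSum_sum_of_ne_finset_zero fun k hk => by
      rw [hg N k (Or.inr (by simp at hk; omega)), zero_mul]
  have hT : HasSum (fun k : ℕ => impulseResponse H k * z ^ k) (H z) := by
    convert! hasSum_taylorSeries_on_ball hH hz using 1
    funext k
    simp [impulseResponse]
    ring
  have hle := (enorm_le_stabilityNorm (h := fun k => impulseResponse H k - g N k) (fun k hk => by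
    simp [impulseResponse, hk.not_ge, hg N k (Or.inl hk)]) (by simpa using hz)
    (by simpa only [sub_mul] using hT.sub hG)).trans hN
  rwa [← ofReal_norm, ENNReal.ofReal_le_ofReal_iff hε.le] at hle

/-! ### Rigidity from boundary values -/

/-- Open mapping theorem: the imaginary axis contains no nonempty open set. -/
theorem eqOn_ball_of_re_eq_zero {F : ℂ → ℂ} (hF : DifferentiableOn ℂ F (ball 0 1))
    (h : ∀ z ∈ ball (0 : ℂ) 1, (F z).re = 0) : ∀ z ∈ ball (0 : ℂ) 1, F z = F 0 := by
  have h0 : (0 : ℂ) ∈ ball (0 : ℂ) 1 := by simp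
  rcases (hF.analyticOnNhd isOpen_ball).is_constant_or_isOpen
    (convex_ball _ _).isPreconnected with ⟨w, hw⟩ | hopen
  · exact fun z hz => (hw z hz).trans (hw 0 h0).symm
  · obtain ⟨ε, hε, hsub⟩ :=
      Metric.isOpen_iff.1 (hopen _ Subset.rfl isOpen_ball) _ (mem_image_of_mem F h0)
    obtain ⟨z, hz, hFz⟩ := hsub (show F 0 + (ε / 2 : ℝ) ∈ ball (F 0) ε by
      rw [mem_ball, dist_self_add_left, Complex.norm_real, Real.norm_of_nonneg (by positivity)]
      linarith)
    have := congrArg Complex.re hFz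
    rw [add_re, ofReal_re, h z hz, h 0 h0] at this
    linarith

theorem norm_exp_I_mul (z : ℂ) : ‖exp (I * z)‖ = Real.exp (-z.im) := by
  simp [norm_exp]

/-- Maximum modulus principle for `exp (I * f)`, whose modulus is `exp (-Im f)`. -/
theorem im_nonneg_of_im_eq_zero_on_sphere {f : ℂ → ℂ} (hf : DiffContOnCl ℂ f (ball 0 1))
    (h : ∀ z ∈ sphere (0 : ℂ) 1, (f z).im = 0) : ∀ z ∈ ball (0 : ℂ) 1, 0 ≤ (f z).im := by
  intro z hz
  have hd : DiffContOnCl ℂ (fun z => exp (I * f z)) (ball 0 1) :=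
    differentiable_exp.comp_diffContOnCl (hf.const_smul I)
  have := norm_le_of_forall_mem_frontier_norm_le isBounded_ball hd (C := 1) (fun w hw => by
    rw [frontier_ball _ one_ne_zero] at hw
    rw [norm_exp_I_mul, h w hw]; simp) (subset_closure hz)
  rw [norm_exp_I_mul, Real.exp_le_one_iff] at this
  linarith

/-- A function in the disk algebra with real boundary values is constant. -/
theorem eqOn_closedBall_of_im_eq_zero_on_sphere {f : ℂ → ℂ} (hf : DiffContOnCl ℂ f (ball 0 1))
    (h : ∀ z ∈ sphere (0 : ℂ) 1, (f z).im = 0) : ∀ z ∈ closedBall (0 : ℂ) 1, f z = f 0 := by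
  have him : ∀ z ∈ ball (0 : ℂ) 1, (f z).im = 0 := fun z hz =>
    le_antisymm (by
      have := im_nonneg_of_im_eq_zero_on_sphere hf.neg (fun z hz => by simp [h z hz]) z hz
      simpa using this) (im_nonneg_of_im_eq_zero_on_sphere hf h z hz)
  have hc : ∀ z ∈ ball (0 : ℂ) 1, f z = f 0 := fun z hz => by
    have := eqOn_ball_of_re_eq_zero (F := fun z => I * f z) (hf.differentiableOn.const_mul I)
      (fun z hz => by simp [him z hz]) z hz
    exact mul_left_cancel₀ I_ne_zero this
  have := EqOn.of_subset_closure (s := ball (0 : ℂ) 1) (t := closedBall 0 1) (g := fun _ => f 0)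
    hc hf.continuousOn_ball continuousOn_const ball_subset_closedBall
    (closure_ball (0 : ℂ) one_ne_zero).ge
  exact this

/-- Only the modulus of `K` is assumed to extend to the circle. If its maximum is attained inside,
the modulus is constant, and continuity carries the value to the circle. -/
theorem norm_le_one_of_continuousOn_norm {K : ℂ → ℂ} {N : ℂ → ℝ}
    (hK : DifferentiableOn ℂ K (ball 0 1)) (hN : ContinuousOn N (closedBall 0 1))
    (hKN : ∀ z ∈ ball (0 : ℂ) 1, ‖K z‖ = N z) (hN1 : ∀ z ∈ sphere (0 : ℂ) 1, N z = 1) :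
    ∀ z ∈ ball (0 : ℂ) 1, ‖K z‖ ≤ 1 := by
  obtain ⟨c, hc, hmax⟩ := (isCompact_closedBall (0 : ℂ) 1).exists_isMaxOn ⟨0, by simp⟩ hN
  suffices N c = 1 from fun z hz =>
    (hKN z hz).trans_le ((hmax (ball_subset_closedBall hz)).trans_eq this)
  rcases (mem_closedBall.1 hc).lt_or_eq with hlt | heq
  · have hcb : c ∈ ball (0 : ℂ) 1 := hlt
    have hconst := norm_eqOn_of_isPreconnected_of_isMaxOn (convex_ball _ _).isPreconnected
      isOpen_ball hK hcb (fun z hz => by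
        simpa [hKN z hz, hKN c hcb] using hmax (ball_subset_closedBall hz))
    have hN' : EqOn N (fun _ => N c) (ball 0 1) := fun z hz => by
      rw [← hKN z hz, ← hKN c hcb]; exact hconst hz
    have := EqOn.of_subset_closure hN' hN continuousOn_const ball_subset_closedBall
      (closure_ball (0 : ℂ) one_ne_zero).ge (show (1 : ℂ) ∈ closedBall 0 1 by simp)
    exact this.symm.trans (hN1 1 (by simp))
  · exact hN1 c heq

/-- An analytic function without zeros in the disk whose modulus extends continuously to the
closed disk with value one on the circle is constant. -/
theorem exists_eqOn_const_of_norm_boundary_eq_one {K : ℂ → ℂ} {N : ℂ → ℝ}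
    (hK : DifferentiableOn ℂ K (ball 0 1)) (hK0 : ∀ z ∈ ball (0 : ℂ) 1, K z ≠ 0)
    (hN : ContinuousOn N (closedBall 0 1)) (hKN : ∀ z ∈ ball (0 : ℂ) 1, ‖K z‖ = N z)
    (hN1 : ∀ z ∈ sphere (0 : ℂ) 1, N z = 1) :
    ∀ z ∈ ball (0 : ℂ) 1, K z = K 0 := by
  have hN0 : ∀ z ∈ closedBall (0 : ℂ) 1, N z ≠ 0 := fun z hz => by
    rcases (mem_closedBall.1 hz).lt_or_eq with hlt | heq
    · rw [← hKN z hlt]; exact norm_ne_zero_iff.2 (hK0 z hlt)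
    · rw [hN1 z heq]; exact one_ne_zero
  have hle := norm_le_one_of_continuousOn_norm hK hN hKN hN1
  have hge := norm_le_one_of_continuousOn_norm (K := fun z => (K z)⁻¹) (N := fun z => (N z)⁻¹)
    (hK.inv hK0) (hN.inv₀ hN0) (fun z hz => by rw [norm_inv, hKN z hz])
    (fun z hz => by rw [hN1 z hz, inv_one])
  have h0 : (0 : ℂ) ∈ ball (0 : ℂ) 1 := by simp
  refine eqOn_of_isPreconnected_of_isMaxOn_norm (convex_ball _ _).isPreconnected isOpen_ball hK h0
    fun z hz => ?_
  have := hge 0 h0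
  rw [norm_inv, inv_le_one₀ (norm_pos_iff.2 (hK0 0 h0))] at this
  exact (hle z hz).trans this

/-! ### The iterated logarithm -/

/-- An analytic function with positive real part in the unit disk and a logarithmic singularity
at `1`. -/
noncomputable def logPole (z : ℂ) : ℂ := 1 - log (1 - z)

theorem one_sub_mem_slitPlane {z : ℂ} (hz : z ∈ closedBall (0 : ℂ) 1) (h1 : z ≠ 1) :
    1 - z ∈ slitPlane := by
  have hn : ‖z‖ ≤ 1 := by simpa using hz
  left
  rw [sub_re, one_re, sub_pos]
  refine lt_of_le_of_ne ((re_le_norm z).trans hn) fun h => h1 ?_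
  have h2 : z.re * z.re + z.im * z.im ≤ 1 := by
    rw [← normSq_apply, normSq_eq_norm_sq]; nlinarith [norm_nonneg z]
  rw [h] at h2
  have him : z.im = 0 := by nlinarith [sq_nonneg z.im]
  exact Complex.ext h him

theorem logPole_re_pos {z : ℂ} (hz : z ∈ closedBall (0 : ℂ) 1) : 0 < (logPole z).re := by
  have hn : ‖z‖ ≤ 1 := by simpa using hz
  have h2 : ‖1 - z‖ ≤ 2 := (norm_sub_le _ _).trans (by rw [norm_one]; linarith)
  rw [logPole, sub_re, one_re, log_re, sub_pos]
  rcases (norm_nonneg (1 - z)).eq_or_lt with h | h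
  -- At `z = 1` the convention `Real.log 0 = 0` gives real part 1.
  · rw [← h]; simp
  · have := Real.log_le_log h h2
    linarith [Real.log_two_lt_d9]

theorem logPole_mem_slitPlane {z : ℂ} (hz : z ∈ closedBall (0 : ℂ) 1) : logPole z ∈ slitPlane :=
  Or.inl (logPole_re_pos hz)

theorem logPole_conj {z : ℂ} (hz : z ∈ closedBall (0 : ℂ) 1) :
    logPole ((starRingEnd ℂ) z) = (starRingEnd ℂ) (logPole z) := by
  rcases eq_or_ne z 1 with rfl | h1
  · simp [logPole]
  · rw [logPole, logPole, map_sub, map_one, ← log_conj _ (slitPlane_arg_ne_pi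
      (one_sub_mem_slitPlane hz h1)), map_sub, map_one]

theorem logPole_zero : logPole 0 = 1 := by simp [logPole]

/-- The logarithm of the density, as a continuous function on the closed disk. -/
noncomputable def logDensity (z : ℂ) : ℝ := -(logPole z).arg

theorem logDensity_conj {z : ℂ} (hz : z ∈ closedBall (0 : ℂ) 1) :
    logDensity ((starRingEnd ℂ) z) = -logDensity z := by
  rw [logDensity, logDensity, logPole_conj hz, arg_conj,
    if_neg (slitPlane_arg_ne_pi (logPole_mem_slitPlane hz))]

theorem tendsto_norm_logPole : Tendsto (fun z => ‖logPole z‖) (𝓝[≠] 1) atTop := by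
  have h1 : Tendsto (fun z : ℂ => ‖1 - z‖) (𝓝[≠] 1) (𝓝[≠] 0) := by
    refine tendsto_nhdsWithin_iff.2 ⟨?_, ?_⟩
    · have : Continuous fun z : ℂ => ‖1 - z‖ := by fun_prop
      simpa using (this.tendsto 1).mono_left nhdsWithin_le_nhds
    · filter_upwards [self_mem_nhdsWithin] with z hz
      simpa [sub_eq_zero] using Ne.symm hz
  have h2 := tendsto_neg_atBot_atTop.comp (Real.tendsto_log_nhdsNE_zero.comp h1)
  refine tendsto_atTop_mono (fun z => ?_) h2
  refine le_trans ?_ (re_le_norm _)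
  simp [logPole, log_re]

/-- The imaginary part of `logPole` is bounded by `π` while its modulus tends to infinity, so its
argument tends to 0. The value at `1` is also 0, thanks to `log 0 = 0`. -/
theorem continuousWithinAt_one_logDensity :
    ContinuousWithinAt logDensity (closedBall 0 1) 1 := by
  have h : Tendsto (fun z => (logPole z).im / ‖logPole z‖) (𝓝[≠] 1) (𝓝 0) := by
    refine squeeze_zero_norm' (a := fun z => Real.pi * ‖logPole z‖⁻¹) (.of_forall fun z => ?_) ?_
    · rw [norm_div, norm_norm, div_eq_mul_inv]
      gcongr
      simpa [logPole, log_im] using abs_arg_le_pi (1 - z)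
    · simpa using tendsto_norm_logPole.inv_tendsto_atTop.const_mul Real.pi
  have h1 : logDensity 1 = 0 := by simp [logDensity, logPole]
  have hd : ContinuousWithinAt logDensity (closedBall 0 1 \ {1}) 1 := by
    have h2 : Tendsto (fun z => -Real.arcsin ((logPole z).im / ‖logPole z‖)) (𝓝[≠] 1) (𝓝 0) := by
      simpa using ((Real.continuous_arcsin.tendsto 0).comp h).neg
    rw [ContinuousWithinAt, h1]
    refine (h2.mono_left (nhdsWithin_mono _ fun z hz => hz.2)).congr' ?_
    filter_upwards [self_mem_nhdsWithin] with z hz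
    rw [logDensity, arg_of_re_nonneg (logPole_re_pos hz.1).le]
  exact continuousWithinAt_sdiff_self.1 hd

theorem continuousOn_logDensity : ContinuousOn logDensity (closedBall 0 1) := by
  intro z hz
  rcases eq_or_ne z 1 with rfl | h1
  · exact continuousWithinAt_one_logDensity
  · refine ContinuousAt.continuousWithinAt ?_
    have hW : ContinuousAt logPole z :=
      continuousAt_const.sub
        ((continuousAt_const.sub continuousAt_id).clog (one_sub_mem_slitPlane hz h1))
    exact ((continuousAt_arg (logPole_mem_slitPlane hz)).comp hW).neg

/-- An analytic function in the disk whose real part extends continuously to the closed disk while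
its imaginary part does not. -/
noncomputable def logLogPole (z : ℂ) : ℂ := I * log (logPole z)

theorem logLogPole_re (z : ℂ) : (logLogPole z).re = logDensity z := by
  simp [logLogPole, logDensity, log_im]

theorem ne_one_of_mem_ball {z : ℂ} (hz : z ∈ ball (0 : ℂ) 1) : z ≠ 1 := by
  rintro rfl; simp at hz

theorem differentiableOn_logLogPole : DifferentiableOn ℂ logLogPole (ball 0 1) := by
  intro z hz
  have hz' := ball_subset_closedBall hz
  have hW : DifferentiableAt ℂ logPole z :=
    (differentiableAt_const _).sub (((differentiableAt_const _).sub differentiableAt_id).clog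
      (one_sub_mem_slitPlane hz' (ne_one_of_mem_ball hz)))
  exact ((hW.clog (logPole_mem_slitPlane hz')).const_mul I).differentiableWithinAt

/-! ### Oscillation along a path to `1` -/

/-- A path in the unit disk that tends to `1`. -/
noncomputable def path (u : ℝ) : ℂ := ((1 - Real.exp (1 - Real.exp u) : ℝ) : ℂ)

theorem path_mem_ball {u : ℝ} (hu : 0 ≤ u) : path u ∈ ball (0 : ℂ) 1 := by
  have h1 : Real.exp (1 - Real.exp u) ≤ 1 := Real.exp_le_one_iff.2 (by
    linarith [Real.one_le_exp hu])
  have h2 := Real.exp_pos (1 - Real.exp u)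
  rw [mem_ball_zero_iff, path, norm_real, Real.norm_eq_abs, abs_lt]
  constructor <;> linarith

theorem tendsto_path : Tendsto path atTop (𝓝 1) := by
  have h : Tendsto (fun u : ℝ => Real.exp (1 - Real.exp u)) atTop (𝓝 0) :=
    Real.tendsto_exp_atBot.comp (tendsto_atBot_add_const_left _ 1
      (tendsto_neg_atTop_atBot.comp Real.tendsto_exp_atTop))
  have := (continuous_ofReal.tendsto _).comp (h.const_sub 1)
  simpa using! this

/-- The path is the solution of `logPole z = exp u`. -/
theorem logLogPole_path (u : ℝ) : logLogPole (path u) = I * u := by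
  have h : logPole (path u) = (Real.exp u : ℝ) := by
    rw [logPole, path, ofReal_sub, ofReal_one, sub_sub_cancel, ← ofReal_log (Real.exp_pos _).le,
      Real.log_exp]
    simp
  rw [logLogPole, h, ← ofReal_log (Real.exp_pos _).le, Real.log_exp]

theorem not_eventually_norm_mul_exp_sub_le {c : ℂ} (hc : c ≠ 0) {b : ℝ} (hb : b ≠ 0) (L : ℂ) :
    ¬ ∀ᶠ u : ℝ in atTop, ‖c * exp (b * (I * u)) - L‖ ≤ ‖c‖ / 3 := by
  intro h
  obtain ⟨u, hu⟩ := eventually_atTop.1 h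
  have h1 := hu u le_rfl
  -- Half a period later the exponential has changed sign, so the two values are `2 * ‖c‖` apart and
  -- cannot both be within `‖c‖ / 3` of `L`.
  have h2 := hu (u + Real.pi / |b|) (by simp only [le_add_iff_nonneg_right]; positivity)
  have hbc : (b : ℂ) ≠ 0 := ofReal_ne_zero.2 hb
  have hneg : exp (b * (I * (u + Real.pi / |b| : ℝ))) = -exp (b * (I * u)) := by
    rcases abs_choice b with hb' | hb'
    · rw [← exp_add_pi_mul_I, hb']
      congr 1
      push_cast
      field_simp
    · rw [← exp_sub_pi_mul_I, hb']
      congr 1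
      push_cast
      field_simp
      ring
  rw [hneg] at h2
  have hE : ‖exp (b * (I * u))‖ = 1 := by
    rw [show (b : ℂ) * (I * u) = ((b * u : ℝ) : ℂ) * I by push_cast; ring, norm_exp_ofReal_mul_I]
  have h3 : ‖(2 : ℂ) * (c * exp (b * (I * u)))‖ = 2 * ‖c‖ := by
    rw [norm_mul, norm_mul, hE]; simp
  have h4 : (2 : ℂ) * (c * exp (b * (I * u))) =
      (c * exp (b * (I * u)) - L) - (c * -exp (b * (I * u)) - L) := by ring
  have h5 := norm_sub_le (c * exp (b * (I * u)) - L) (c * -exp (b * (I * u)) - L)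
  rw [← h4, h3] at h5
  have := norm_pos_iff.2 hc
  linarith

theorem not_tendsto_of_eq_mul_exp {f : ℂ → ℂ} {c : ℂ} (hc : c ≠ 0) {b : ℝ} (hb : b ≠ 0)
    (hf : ∀ u : ℝ, 0 ≤ u → f (path u) = c * exp (b * (I * u))) (L : ℂ) :
    ¬ Tendsto (fun u => f (path u)) atTop (𝓝 L) := by
  intro h
  refine not_eventually_norm_mul_exp_sub_le hc hb L ?_
  filter_upwards [h (closedBall_mem_nhds L (show 0 < ‖c‖ / 3 by positivity)), eventually_ge_atTop 0]
    with u hu h0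
  simpa only [hf u h0, dist_eq_norm, mem_preimage, mem_closedBall] using hu

theorem tendsto_path_closedBall : Tendsto path atTop (𝓝[closedBall 0 1] 1) :=
  tendsto_nhdsWithin_iff.2 ⟨tendsto_path, (eventually_ge_atTop 0).mono fun _ hu =>
    ball_subset_closedBall (path_mem_ball hu)⟩

theorem tendsto_path_of_diffContOnCl {g : ℂ → ℂ} (hg : DiffContOnCl ℂ g (ball 0 1)) :
    Tendsto (fun u => g (path u)) atTop (𝓝 (g 1)) :=
  (hg.continuousOn_ball 1 (by simp)).tendsto.comp tendsto_path_closedBall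

theorem not_memDiskAlgebra_of_eq_mul_exp {f : ℂ → ℂ} {c : ℂ} (hc : c ≠ 0) {b : ℝ} (hb : b ≠ 0)
    (hf : ∀ u : ℝ, 0 ≤ u → f (path u) = c * exp (b * (I * u))) : ¬ MemDiskAlgebra f := by
  rintro ⟨g, hg, hfg⟩
  exact not_tendsto_of_eq_mul_exp (f := g) hc hb
    (fun u hu => (hfg (path_mem_ball hu)).symm.trans (hf u hu)) _ (tendsto_path_of_diffContOnCl hg)

/-! ### The density and its outer exponent -/

/-- The density on the unit circle with logarithm `logDensity`. -/
noncomputable def density (ω : ℝ) : ℝ := Real.exp (logDensity (exp (I * ω)))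

theorem exp_I_mul_mem_sphere (ω : ℝ) : exp (I * ω) ∈ sphere (0 : ℂ) 1 := by
  rw [mul_comm]; simp [norm_exp_ofReal_mul_I]

theorem continuous_density : Continuous density := by
  refine Real.continuous_exp.comp (continuousOn_logDensity.comp_continuous (by fun_prop) fun ω => ?_)
  exact sphere_subset_closedBall (exp_I_mul_mem_sphere ω)

theorem isPositiveContinuousDensity_density : IsPositiveContinuousDensity density where
  continuousOn := continuous_density.continuousOn
  tendsto_endpoint := by
    have h : density (-Real.pi) = density Real.pi := by
      simp [density, mul_comm I, exp_neg]
    rw [h]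
    exact (continuous_density.tendsto _).mono_left nhdsWithin_le_nhds
  pos := fun _ _ => Real.exp_pos _

theorem harmonicContOnCl_logDensity :
    InnerProductSpace.HarmonicContOnCl logDensity (ball 0 1) := by
  refine .mk_ball (fun z hz => ?_) continuousOn_logDensity
  have := (differentiableOn_logLogPole.analyticAt (isOpen_ball.mem_nhds hz)).harmonicAt_re
  simpa only [logLogPole_re] using! this

theorem circleIntegrable_logDensity : CircleIntegrable logDensity 0 1 :=
  (continuousOn_logDensity.mono sphere_subset_closedBall).circleIntegrable zero_le_one

theorem outerExponent_density_eq_circleAverage (z : ℂ) : outerExponent density z =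
    Real.circleAverage (fun ζ => herglotzRieszKernel 0 z ζ • (logDensity ζ : ℂ)) 0 1 := by
  rw [Real.circleAverage_eq_integral_add (-Real.pi), intervalIntegral.integral_comp_add_right
    (fun θ => herglotzRieszKernel 0 z (circleMap 0 1 θ) • (logDensity (circleMap 0 1 θ) : ℂ)),
    outerExponent, real_smul]
  congr 1
  · push_cast; ring
  · rw [show (0 : ℝ) + -Real.pi = -Real.pi by ring,
      show 2 * Real.pi + -Real.pi = Real.pi by ring]
    refine intervalIntegral.integral_congr fun τ _ => ?_
    simp [density, herglotzRieszKernel_def, circleMap, mul_comm]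

theorem circleIntegrable_ofReal_logDensity :
    CircleIntegrable (fun ζ => (logDensity ζ : ℂ)) 0 1 :=
  (continuous_ofReal.comp_continuousOn
    (continuousOn_logDensity.mono sphere_subset_closedBall)).circleIntegrable zero_le_one

/-- Poisson's formula for a harmonic function continuous up to the circle. -/
theorem outerExponent_density_re {z : ℂ} (hz : z ∈ ball (0 : ℂ) 1) :
    (outerExponent density z).re = logDensity z := by
  rw [outerExponent_density_eq_circleAverage,
    re_circleAverage_herglotzRieszKernel_smul circleIntegrable_logDensity hz,
    harmonicContOnCl_logDensity.circleAverage_re_herglotzRieszKernel_smul hz]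

theorem outerExponent_density_zero_im : (outerExponent density 0).im = 0 := by
  rw [outerExponent]
  have : (∫ τ in (-Real.pi)..Real.pi, (Real.log (density τ) : ℂ) *
      ((exp (I * τ) + 0) / (exp (I * τ) - 0))) =
      ((∫ τ in (-Real.pi)..Real.pi, Real.log (density τ) : ℝ) : ℂ) := by
    rw [← intervalIntegral.integral_ofReal]
    simp
  rw [this, show (1 : ℂ) / (2 * Real.pi) = ((1 / (2 * Real.pi) : ℝ) : ℂ) by push_cast; rfl,
    ← ofReal_mul, ofReal_im]

theorem differentiableOn_outerExponent_density :
    DifferentiableOn ℂ (outerExponent density) (ball 0 1) := by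
  intro z hz
  rw [funext outerExponent_density_eq_circleAverage]
  exact (hasDerivAt_circleAverage_herglotzRieszKernel_smul circleIntegrable_ofReal_logDensity
    hz).differentiableAt.differentiableWithinAt

/-- Equal real parts leave only an imaginary constant, which the value at 0 excludes. -/
theorem outerExponent_density {z : ℂ} (hz : z ∈ ball (0 : ℂ) 1) :
    outerExponent density z = logLogPole z := by
  have h0 : (0 : ℂ) ∈ ball (0 : ℂ) 1 := by simp
  have h := eqOn_ball_of_re_eq_zero (F := fun z => outerExponent density z - logLogPole z)
    (differentiableOn_outerExponent_density.sub differentiableOn_logLogPole)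
    (fun z hz => by rw [sub_re, outerExponent_density_re hz, logLogPole_re, sub_self]) z hz
  have hl : logLogPole 0 = 0 := by simp [logLogPole, logPole_zero]
  have hz0 : outerExponent density 0 = 0 := by
    refine Complex.ext ?_ outerExponent_density_zero_im
    rw [outerExponent_density_re h0, ← logLogPole_re, hl]
  simp only [hz0, hl, sub_zero] at h
  exact sub_eq_zero.1 h

/-! ### Spectral factors, whitening filter and FIR approximation -/

theorem spectralPlus_density {z : ℂ} (hz : z ∈ ball (0 : ℂ) 1) :
    spectralPlus density z = exp (logLogPole z / 2) := by
  rw [spectralPlus, outerExponent_density hz]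

theorem whiteningFilter_density {z : ℂ} (hz : z ∈ ball (0 : ℂ) 1) :
    whiteningFilter density z = exp (-(logLogPole z / 2)) := by
  rw [whiteningFilter, spectralPlus_density hz, exp_neg, one_div]

theorem conj_path (u : ℝ) : (starRingEnd ℂ) (path u) = path u := conj_ofReal _

theorem spectralPlus_density_path {u : ℝ} (hu : 0 ≤ u) :
    spectralPlus density (path u) = 1 * exp ((1 / 2 : ℝ) * (I * u)) := by
  rw [spectralPlus_density (path_mem_ball hu), logLogPole_path, one_mul]
  congr 1; push_cast; ring

theorem spectralMinus_density_path {u : ℝ} (hu : 0 ≤ u) :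
    spectralMinus density (1 / path u) = 1 * exp ((-1 / 2 : ℝ) * (I * u)) := by
  rw [spectralMinus, map_div₀, map_one, conj_path, one_div_one_div, spectralPlus_density_path hu,
    one_mul, one_mul, ← exp_conj]
  congr 1
  simp only [map_mul, conj_I, conj_ofReal]
  push_cast; ring

theorem whiteningFilter_density_path {u : ℝ} (hu : 0 ≤ u) :
    whiteningFilter density (path u) = 1 * exp ((-1 / 2 : ℝ) * (I * u)) := by
  rw [whiteningFilter_density (path_mem_ball hu), logLogPole_path, one_mul]
  congr 1; push_cast; ring

theorem differentiableOn_whiteningFilter_density :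
    DifferentiableOn ℂ (whiteningFilter density) (ball 0 1) :=
  ((differentiableOn_logLogPole.div_const 2).neg.cexp).congr fun _ hz => whiteningFilter_density hz

theorem not_FIRApproximable_density :
    ¬ FIRApproximable (impulseResponse (whiteningFilter density)) := by
  intro h
  obtain ⟨G, hG, hle⟩ := h.exists_continuous_norm_sub_le differentiableOn_whiteningFilter_density
    -- One sixth for the approximation and one sixth for the continuity of `G` at `1` add up to the
    -- threshold `1 / 3`.
    (show (0 : ℝ) < 1 / 6 by norm_num)
  refine not_eventually_norm_mul_exp_sub_le one_ne_zero (b := -1 / 2) (by norm_num) (G 1) ?_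
  have ht : Tendsto (fun u => G (path u)) atTop (𝓝 (G 1)) := (hG.tendsto 1).comp tendsto_path
  filter_upwards [ht (closedBall_mem_nhds _ (show (0 : ℝ) < 1 / 6 by norm_num)),
    eventually_ge_atTop 0] with u hu h0
  have h1 := hle _ (path_mem_ball h0)
  rw [whiteningFilter_density_path h0] at h1
  have h2 : ‖G (path u) - G 1‖ ≤ 1 / 6 := by
    simpa only [mem_preimage, mem_closedBall, dist_eq_norm] using hu
  have h3 := norm_add_le (1 * exp ((-1 / 2 : ℝ) * (I * u)) - G (path u)) (G (path u) - G 1)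
  rw [sub_add_sub_cancel] at h3
  rw [norm_one]
  linarith

/-! ### No factorization in the disk algebra -/

theorem diffContOnCl_conj_conj {Q : ℂ → ℂ} (hQ : DiffContOnCl ℂ Q (ball 0 1)) :
    DiffContOnCl ℂ (fun z => (starRingEnd ℂ) (Q ((starRingEnd ℂ) z))) (ball 0 1) := by
  refine .mk_ball (fun z hz => ?_) ?_
  · have hz' : (starRingEnd ℂ) z ∈ ball (0 : ℂ) 1 := by simpa using hz
    have hd : DifferentiableAt ℂ Q ((starRingEnd ℂ) z) :=
      hQ.differentiableAt isOpen_ball hz'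
    have := hd.conj_conj
    rw [conj_conj] at this
    exact this.differentiableWithinAt
  · refine continuous_conj.comp_continuousOn
      (hQ.continuousOn_ball.comp continuous_conj.continuousOn fun z hz => ?_)
    simpa using hz

/-- Boundary relation of a spectral factorization of `density` in the disk algebra. -/
theorem mul_eq_exp_neg_logDensity {P M Q : ℂ → ℂ} (hfac : IsSpectralFactorization density P M)
    (hQ : ∀ z : ℂ, z ≠ 0 → ‖z‖ ≤ 1 → Q z = M (1 / z)) {ζ : ℂ} (hζ : ζ ∈ sphere (0 : ℂ) 1) :
    P ζ * Q ((starRingEnd ℂ) ζ) = (Real.exp (-logDensity ζ) : ℝ) := by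
  have hn : ‖ζ‖ = 1 := by simpa using hζ
  have hinv : (starRingEnd ℂ) ζ = ζ⁻¹ := by
    rw [inv_def, normSq_eq_norm_sq, hn]; simp
  have h0 : ζ ≠ 0 := norm_ne_zero_iff.1 (by rw [hn]; exact one_ne_zero)
  have hQζ : Q ((starRingEnd ℂ) ζ) = M ζ := by
    rw [hQ _ (by simpa using h0) (by simp [hn]), hinv, one_div, inv_inv]
  have harg : exp (I * ζ.arg) = ζ := by
    conv_rhs => rw [← norm_mul_exp_arg_mul_I ζ, hn]
    rw [mul_comm]; simp
  -- The factors are evaluated at `exp (-(I * ω))`, hence `ω = -arg ζ`; this also turns `arg`'s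
  -- range `(-π, π]` into `[-π, π)`.
  have hf := hfac.factor (-ζ.arg) ⟨by linarith [arg_le_pi ζ], by linarith [neg_pi_lt_arg ζ]⟩
  rw [ofReal_neg, mul_neg, neg_neg, harg] at hf
  rw [hQζ, ← hf, density, ofReal_neg, mul_neg, exp_neg, harg, ← hinv,
    logDensity_conj (sphere_subset_closedBall hζ)]

theorem not_exists_factorization_density : ¬ ∃ P M : ℂ → ℂ,
    IsSpectralFactorization density P M ∧ FactorsInDiskAlgebra P M := by
  rintro ⟨P, M, hfac, hP, Q, hQ, hQM⟩
  have hb := fun ζ (hζ : ζ ∈ sphere (0 : ℂ) 1) => mul_eq_exp_neg_logDensity hfac hQM hζ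
  have hP0 : ∀ z ∈ closedBall (0 : ℂ) 1, P z ≠ 0 := fun z hz h => by
    rcases (mem_closedBall.1 hz).lt_or_eq with hlt | heq
    · exact hfac.plus_ne_zero z (by simpa using hlt) h
    · have := hb z heq
      rw [h, zero_mul] at this
      exact (Real.exp_pos _).ne (ofReal_injective this)
  have hcl : closure (ball (0 : ℂ) 1) = closedBall 0 1 := closure_ball _ one_ne_zero
  -- On the circle `R` is the conjugate of `M`, so `R / P` is the positive number `P * M` divided by
  -- `‖P‖ ^ 2`.
  set R : ℂ → ℂ := fun z => (starRingEnd ℂ) (Q ((starRingEnd ℂ) z))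
  have hf : DiffContOnCl ℂ (fun z => (P z)⁻¹ * R z) (ball 0 1) :=
    (hP.inv (by rwa [hcl])).smul (diffContOnCl_conj_conj hQ)
  have hbd : ∀ ζ ∈ sphere (0 : ℂ) 1,
      (P ζ)⁻¹ * R ζ = ((Real.exp (-logDensity ζ) / ‖P ζ‖ ^ 2 : ℝ) : ℂ) := fun ζ hζ => by
    have h0 := hP0 ζ (sphere_subset_closedBall hζ)
    have h1 := congrArg (starRingEnd ℂ) (hb ζ hζ)
    rw [map_mul, conj_ofReal] at h1
    have h2 : (starRingEnd ℂ) (P ζ) ≠ 0 := by simpa using h0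
    rw [ofReal_div, ← h1, ofReal_pow, ← mul_conj']
    simp only [R]
    field_simp
  set c : ℂ := (P 0)⁻¹ * R 0
  have hconst : ∀ z ∈ closedBall (0 : ℂ) 1, (P z)⁻¹ * R z = c :=
    eqOn_closedBall_of_im_eq_zero_on_sphere hf fun z hz => by rw [hbd z hz, ofReal_im]
  have hcP : ∀ ζ ∈ sphere (0 : ℂ) 1, ‖c‖ * ‖P ζ‖ ^ 2 = Real.exp (-logDensity ζ) := fun ζ hζ => by
    have h0 := norm_ne_zero_iff.2 (hP0 ζ (sphere_subset_closedBall hζ))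
    rw [← hconst ζ (sphere_subset_closedBall hζ), hbd ζ hζ, norm_real,
      Real.norm_of_nonneg (by positivity)]
    field_simp
  have hc0 : c ≠ 0 := fun h => by
    have := hcP 1 (by simp)
    rw [h, norm_zero, zero_mul] at this
    exact (Real.exp_pos _).ne this
  have hball := fun z (hz : z ∈ ball (0 : ℂ) 1) => hP0 z (ball_subset_closedBall hz)
  have hK0 : ∀ z ∈ ball (0 : ℂ) 1, c * P z ^ 2 * exp (logLogPole z) ≠ 0 := fun z hz =>
    mul_ne_zero (mul_ne_zero hc0 (pow_ne_zero 2 (hball z hz))) (exp_ne_zero _)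
  -- `logLogPole` has no continuous extension to the circle, but the modulus of `exp (logLogPole z)`
  -- does.
  have hK := exists_eqOn_const_of_norm_boundary_eq_one
    (K := fun z => c * P z ^ 2 * exp (logLogPole z))
    (N := fun z => ‖c‖ * ‖P z‖ ^ 2 * Real.exp (logDensity z))
    (((hP.differentiableOn.pow 2).const_mul c).mul differentiableOn_logLogPole.cexp) hK0
    ((continuousOn_const.mul (hP.continuousOn_ball.norm.pow 2)).mul continuousOn_logDensity.rexp)
    (fun z _ => by rw [norm_mul, norm_mul, norm_pow, norm_exp, logLogPole_re])
    (fun z hz => by rw [hcP z hz, ← Real.exp_add, neg_add_cancel, Real.exp_zero])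
  set k : ℂ := c * P 0 ^ 2 * exp (logLogPole 0)
  have hk0 : k ≠ 0 := hK0 0 (by simp)
  refine not_tendsto_of_eq_mul_exp (f := fun z => P z ^ 2) (c := k / c) (div_ne_zero hk0 hc0)
    (b := -1) (by norm_num) (fun u hu => ?_) (P 1 ^ 2) ((tendsto_path_of_diffContOnCl hP).pow 2)
  have h := hK _ (path_mem_ball hu)
  simp only [logLogPole_path] at h
  rw [← h, ofReal_neg, ofReal_one, neg_one_mul, exp_neg]
  have := exp_ne_zero (I * u)
  field_simp

end WienerFilter

theorem corollary2 :
    ∃ Φ : ℝ → ℝ, WienerFilter.IsPositiveContinuousDensity Φ ∧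
      (¬ ∃ P M : ℂ → ℂ, WienerFilter.IsSpectralFactorization Φ P M ∧
        WienerFilter.FactorsInDiskAlgebra P M) ∧
      ¬ WienerFilter.MemDiskAlgebra (WienerFilter.spectralPlus Φ) ∧
      ¬ WienerFilter.MemDiskAlgebra (fun z => WienerFilter.spectralMinus Φ (1 / z)) ∧
      ¬ WienerFilter.MemDiskAlgebra (WienerFilter.whiteningFilter Φ) ∧
      ¬ WienerFilter.FIRApproximable
        (WienerFilter.impulseResponse (WienerFilter.whiteningFilter Φ)) := by
  open WienerFilter in
  exact ⟨density, isPositiveContinuousDensity_density, not_exists_factorization_density,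
    not_memDiskAlgebra_of_eq_mul_exp one_ne_zero (b := 1 / 2) (by norm_num)
      fun _ => spectralPlus_density_path,
    not_memDiskAlgebra_of_eq_mul_exp one_ne_zero (b := -1 / 2) (by norm_num)
      fun _ => spectralMinus_density_path,
    not_memDiskAlgebra_of_eq_mul_exp one_ne_zero (b := -1 / 2) (by norm_num)
      fun _ => whiteningFilter_density_path,
    not_FIRApproximable_density⟩
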